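/- For positive integers $i_1\ge 2,\ i_2,\dots,i_k\ge 1$ let $$\zeta(i_1,\dots,i_k)=\sum_{n_1>n_2>\cdots>n_k\ge 1}\frac{1}{n_1^{i_1}n_2^{i_2}\cdots n_k^{i_k}}$$ be the multiple zeta value, and write $\zeta(3,\{2\}^N)=\zeta(3,\underbrace{2,\dots,2}_{N})$. Let $\zeta$ (with one argument) be the Riemann zeta function and let $\eta(m)=(1-2^{1-m})\,\zeta(m)$ for integers $m\ge 2$ be the Dirichlet eta function. Then for every integer $N\ge 0$ the series defining $\zeta(3,\{2\}^N)$ converges and $$\zeta(3,\{2\}^N)=2\left[\sum_{j=1}^{N}\frac{(-1)^{j+1}(2j)\,\pi^{2N+2-2j}}{(2N+3-2j)!}\,\eta(2j+1)-(-1)^N\Bigl[1-\bigl(1-2^{-2N-2}\bigr)(2N+2)\Bigr]\zeta(2N+3)\right].$$ -/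

import Mathlib

/-- The index set of a multiple zeta value of depth `k`: tuples of integers
`n₁ > n₂ > ⋯ > n_k ≥ 1` (`n 0` is the largest entry `n₁`). -/
abbrev MZVIndex (k : ℕ) : Type :=
  {n : Fin k → ℕ // StrictAnti n ∧ ∀ j, 1 ≤ n j}

/-- The summand `1 / (n₁ ^ i₁ ⋯ n_k ^ i_k)`. -/
noncomputable def mzvTerm {k : ℕ} (i : Fin k → ℕ) (n : MZVIndex k) : ℝ :=
  1 / ∏ j, (n.1 j : ℝ) ^ i j

/-- The multiple zeta value
`ζ(i₁, …, i_k) = ∑_{n₁ > ⋯ > n_k ≥ 1} 1 / (n₁ ^ i₁ ⋯ n_k ^ i_k)`.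
It is meaningful when the family `mzvTerm i` is summable. -/
noncomputable def multipleZeta {k : ℕ} (i : Fin k → ℕ) : ℝ :=
  ∑' n : MZVIndex k, mzvTerm i n

/-- The index `(3, {2}^N) = (3, 2, …, 2)` with `N` twos. -/
def threeTwos (N : ℕ) : Fin (N + 1) → ℕ :=
  Fin.cons 3 (fun _ => 2)

/-- The Dirichlet eta function at a natural number: `η(m) = (1 - 2^(1-m)) ζ(m)`,
with `η(1) = log 2`. -/
noncomputable def dirichletEtaNat (m : ℕ) : ℂ :=
  if m = 1 then (Real.log 2 : ℂ)
  else (1 - (2 : ℂ) ^ (1 - (m : ℤ))) * riemannZeta m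

/-!
The proof goes through the integral representation
`π (2N+2)! ζ(3, {2}^N) = ∫₀^π θ^(2N+2) (π - θ) cot(θ/2) dθ`
(`hasSum_truncTwos_div_cube`), which is then evaluated by the sine series of the cotangent.

Splitting off the largest index, `ζ(3, {2}^N) = ∑_m e_N(m) / m³` with `e_N(m)` the multiple zeta
value `ζ({2}^N)` truncated to indices below `m` (`hasSum_mzvTerm_threeTwos`). The same coefficients
occur in the power series of even powers of the arcsine:
`θ^(2N+2) / (2N+2)! = ∑_{m ≥ 1} σ_m(θ) e_N(m) / m²`, where
`σ_m(θ) = (4^m / C(2m,m)) sin(θ/2)^(2m)`. This holds because `σ_m'' = m² (σ_{m-1} - σ_m)`, so that,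
after summation by parts, two derivatives lower the depth `N` by one. For partial sums the same
computation leaves a remainder involving `σ_n` alone, and an induction on the depth bounds the error
of the expansion by a constant times `σ_n(θ)`, which tends to `0` for `θ < π`
(`exists_arcsinGap_le`). Since `σ_m` has mean `1` on `[0, π]`, integration by parts gives
`∫₀^π σ_m(θ) (π - θ) cot(θ/2) dθ = π / m`, and integrating the expansion against this weight yields
the representation.

For the evaluation, `cot(θ/2)` equals `2 ∑_{k ≤ n} sin(kθ)` up to a term which the Riemann-Lebesgue
lemma removes in the limit (`tendsto_sum_integral_sin`). The integrals of `θ^(2N+2) (π - θ) sin(kθ)`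
are found by repeated integration by parts: the only boundary term at `0` produces `ζ(2N+3)`, and
those at `π`, which carry a sign `(-1)^k`, produce the eta values.
-/

open Finset Filter Topology Real MeasureTheory intervalIntegral
open scoped ENNReal Nat

/-! ### Splitting off the largest summation index -/

/-- The truncated multiple zeta value `∑_{n > m₁ > ⋯ > m_k ≥ 1} 1 / (m₁² ⋯ m_k²)`, by recursion on
the depth. The term `a = 0` of each sum is `0`, since `x / 0 = 0`. -/
noncomputable def truncTwos : ℕ → ℕ → ℝ
  | 0, _ => 1
  | k + 1, n => ∑ a ∈ range n, truncTwos k a / (a : ℝ) ^ 2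

theorem truncTwos_nonneg (k n : ℕ) : 0 ≤ truncTwos k n := by
  induction k generalizing n with
  | zero => simp [truncTwos]
  | succ k ih => exact sum_nonneg fun a _ => div_nonneg (ih a) (by positivity)

theorem exists_truncTwos_le (k : ℕ) : ∃ C : ℝ, 0 ≤ C ∧ ∀ n, truncTwos k n ≤ C := by
  induction k with
  | zero => exact ⟨1, by simp, fun n => by simp [truncTwos]⟩
  | succ k ih =>
    obtain ⟨C, hC, h⟩ := ih
    have hs : Summable fun a : ℕ => 1 / (a : ℝ) ^ 2 :=
      Real.summable_one_div_nat_pow.2 (by norm_num)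
    refine ⟨C * ∑' a : ℕ, 1 / (a : ℝ) ^ 2, mul_nonneg hC (tsum_nonneg fun a => by positivity),
      fun n => ?_⟩
    calc truncTwos (k + 1) n ≤ ∑ a ∈ range n, C * (1 / (a : ℝ) ^ 2) := by
          refine sum_le_sum fun a _ => ?_
          rw [mul_one_div]
          exact div_le_div_of_nonneg_right (h a) (by positivity)
      _ = C * ∑ a ∈ range n, 1 / (a : ℝ) ^ 2 := by rw [mul_sum]
      _ ≤ _ := mul_le_mul_of_nonneg_left
          (hs.sum_le_tsum _ fun a _ => by positivity) hC

theorem strictAnti_cons_iff {k : ℕ} {a : ℕ} {m : Fin k → ℕ} :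
    StrictAnti (Fin.cons a m : Fin (k + 1) → ℕ) ↔ StrictAnti m ∧ ∀ j, m j < a := by
  constructor
  · intro h
    refine ⟨fun i j hij => ?_, fun j => ?_⟩
    · simpa using h (Fin.succ_lt_succ_iff.2 hij)
    · simpa using h (Fin.succ_pos j)
  · rintro ⟨h, h'⟩ i j hij
    induction j using Fin.cases with
    | zero => exact absurd hij (Fin.not_lt_zero i)
    | succ j =>
      induction i using Fin.cases with
      | zero => simpa using h' j
      | succ i => simpa using h (Fin.succ_lt_succ_iff.1 hij)

open Classical in
/-- In `ℝ≥0∞` no convergence questions arise, so the largest index can be split off freely. -/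
theorem tsum_truncated_eq_truncTwos (k n : ℕ) :
    ∑' m : Fin k → ℕ, (if StrictAnti m ∧ ∀ j, 1 ≤ m j ∧ m j < n then
      ENNReal.ofReal (1 / ∏ j, (m j : ℝ) ^ 2) else 0) = ENNReal.ofReal (truncTwos k n) := by
  induction k generalizing n with
  | zero =>
    rw [tsum_eq_single default (fun b hb => absurd (Subsingleton.elim b _) hb)]
    rw [if_pos ⟨Subsingleton.strictAnti _, fun j => j.elim0⟩]
    simp [truncTwos]
  | succ k ih =>
    rw [← (Fin.consEquiv fun _ => ℕ).tsum_eq, ENNReal.tsum_prod']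
    have key : ∀ a : ℕ, (∑' m : Fin k → ℕ,
        (if StrictAnti (Fin.consEquiv (fun _ => ℕ) (a, m)) ∧
            ∀ j, 1 ≤ Fin.consEquiv (fun _ => ℕ) (a, m) j ∧
              Fin.consEquiv (fun _ => ℕ) (a, m) j < n then
          ENNReal.ofReal (1 / ∏ j, (Fin.consEquiv (fun _ => ℕ) (a, m) j : ℝ) ^ 2) else 0)) =
        if a ∈ range n then ENNReal.ofReal (truncTwos k a / (a : ℝ) ^ 2) else 0 := by
      intro a
      by_cases ha : 1 ≤ a ∧ a < n
      · rw [if_pos (mem_range.2 ha.2), div_eq_mul_one_div, mul_comm,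
          ENNReal.ofReal_mul (by positivity), ← ih a, ← ENNReal.tsum_mul_left]
        refine tsum_congr fun m => ?_
        have hiff : (StrictAnti (Fin.consEquiv (fun _ => ℕ) (a, m)) ∧
            ∀ j, 1 ≤ Fin.consEquiv (fun _ => ℕ) (a, m) j ∧
              Fin.consEquiv (fun _ => ℕ) (a, m) j < n) ↔
            StrictAnti m ∧ ∀ j, 1 ≤ m j ∧ m j < a := by
          rw [show Fin.consEquiv (fun _ => ℕ) (a, m) = (Fin.cons a m : Fin (k + 1) → ℕ) from rfl,
            strictAnti_cons_iff]
          simp only [Fin.forall_fin_succ, Fin.cons_zero, Fin.cons_succ]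
          constructor
          · rintro ⟨⟨h1, h2⟩, h3, h4⟩
            exact ⟨h1, fun j => ⟨(h4 j).1, h2 j⟩⟩
          · rintro ⟨h1, h2⟩
            exact ⟨⟨h1, fun j => (h2 j).2⟩, ha, fun j => ⟨(h2 j).1, (h2 j).2.trans ha.2⟩⟩
        rw [if_congr hiff rfl rfl]
        split_ifs
        · rw [← ENNReal.ofReal_mul (by positivity)]
          simp [Fin.prod_univ_succ, Fin.consEquiv_apply, mul_comm]
        · simp
      · have h0 : ∀ m : Fin k → ℕ, ¬ (StrictAnti (Fin.consEquiv (fun _ => ℕ) (a, m)) ∧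
            ∀ j, 1 ≤ Fin.consEquiv (fun _ => ℕ) (a, m) j ∧
              Fin.consEquiv (fun _ => ℕ) (a, m) j < n) := fun m h => ha (by simpa using h.2 0)
        simp only [h0, if_false, tsum_zero]
        split_ifs with h1
        · have : a = 0 := by
            by_contra h
            exact ha ⟨Nat.pos_of_ne_zero h, mem_range.1 h1⟩
          simp [this]
        · rfl
    simp only [key]
    rw [tsum_eq_sum (s := range n) (fun a ha => if_neg ha), truncTwos,
      ENNReal.ofReal_sum_of_nonneg fun a _ => div_nonneg (truncTwos_nonneg k a) (by positivity)]
    exact sum_congr rfl fun a ha => if_pos ha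

open Classical in
theorem tsum_mzvTerm_threeTwos (N : ℕ) :
    ∑' n : MZVIndex (N + 1), ENNReal.ofReal (mzvTerm (threeTwos N) n) =
      ∑' a : ℕ, ENNReal.ofReal (truncTwos N (a + 1) / ((a + 1 : ℕ) : ℝ) ^ 3) := by
  let F : (Fin (N + 1) → ℕ) → ℝ≥0∞ := fun n =>
    ENNReal.ofReal (1 / ∏ j, (n j : ℝ) ^ threeTwos N j)
  change ∑' n : {n : Fin (N + 1) → ℕ // StrictAnti n ∧ ∀ j, 1 ≤ n j}, F n.1 = _
  have h1 := tsum_subtype {n : Fin (N + 1) → ℕ | StrictAnti n ∧ ∀ j, 1 ≤ n j} F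
  refine h1.trans ?_
  rw [← (Fin.consEquiv fun _ => ℕ).tsum_eq, ENNReal.tsum_prod']
  have key : ∀ a : ℕ, (∑' m : Fin N → ℕ,
      Set.indicator {n : Fin (N + 1) → ℕ | StrictAnti n ∧ ∀ j, 1 ≤ n j} F
        (Fin.consEquiv (fun _ => ℕ) (a, m))) =
      ENNReal.ofReal (truncTwos N a / (a : ℝ) ^ 3) := by
    intro a
    by_cases ha : 1 ≤ a
    · rw [div_eq_mul_one_div, mul_comm,
        ENNReal.ofReal_mul (by positivity), ← tsum_truncated_eq_truncTwos, ← ENNReal.tsum_mul_left]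
      refine tsum_congr fun m => ?_
      have hiff : Fin.consEquiv (fun _ => ℕ) (a, m) ∈
          {n : Fin (N + 1) → ℕ | StrictAnti n ∧ ∀ j, 1 ≤ n j} ↔
          StrictAnti m ∧ ∀ j, 1 ≤ m j ∧ m j < a := by
        rw [show Fin.consEquiv (fun _ => ℕ) (a, m) = (Fin.cons a m : Fin (N + 1) → ℕ) from rfl,
          Set.mem_ofPred_eq, strictAnti_cons_iff]
        simp only [Fin.forall_fin_succ, Fin.cons_zero, Fin.cons_succ]
        constructor
        · rintro ⟨⟨h1, h2⟩, h3, h4⟩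
          exact ⟨h1, fun j => ⟨h4 j, h2 j⟩⟩
        · rintro ⟨h1, h2⟩
          exact ⟨⟨h1, fun j => (h2 j).2⟩, ha, fun j => (h2 j).1⟩
      rw [Set.indicator_apply, if_congr hiff rfl rfl]
      split_ifs
      · rw [← ENNReal.ofReal_mul (by positivity)]
        simp [F, threeTwos, Fin.prod_univ_succ, Fin.consEquiv_apply, mul_comm]
      · simp
    · have h0 : ∀ m : Fin N → ℕ, Fin.consEquiv (fun _ => ℕ) (a, m) ∉
          {n : Fin (N + 1) → ℕ | StrictAnti n ∧ ∀ j, 1 ≤ n j} :=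
        fun m h => ha (by simpa using h.2 0)
      simp only [Set.indicator_of_notMem (h0 _), tsum_zero]
      have : a = 0 := by omega
      simp [this]
  simp only [key]
  rw [tsum_eq_zero_add' ENNReal.summable]
  simp

/-- Splitting off the largest index: a multiple zeta value `ζ(3, {2}^N)` is a single series whose
coefficients are truncated multiple zeta values. -/
theorem hasSum_mzvTerm_threeTwos {N : ℕ} {s : ℝ}
    (h : HasSum (fun a : ℕ => truncTwos N (a + 1) / ((a + 1 : ℕ) : ℝ) ^ 3) s) :
    HasSum (mzvTerm (threeTwos N)) s := by
  have hnn : ∀ n, 0 ≤ mzvTerm (threeTwos N) n := fun n => by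
    unfold mzvTerm; positivity
  have hnn' : ∀ a : ℕ, 0 ≤ truncTwos N (a + 1) / ((a + 1 : ℕ) : ℝ) ^ 3 := fun a =>
    div_nonneg (truncTwos_nonneg _ _) (by positivity)
  have hs : ∑' n : MZVIndex (N + 1), ENNReal.ofReal (mzvTerm (threeTwos N) n) =
      ENNReal.ofReal s := by
    rw [tsum_mzvTerm_threeTwos, ← ENNReal.ofReal_tsum_of_nonneg hnn' h.summable, h.tsum_eq]
  have h2 := ENNReal.hasSum_toReal (hs.trans_ne ENNReal.ofReal_ne_top)
  rw [← ENNReal.tsum_toReal_eq fun _ => ENNReal.ofReal_ne_top, hs,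
    ENNReal.toReal_ofReal (h.nonneg hnn')] at h2
  simpa only [ENNReal.toReal_ofReal (hnn _)] using h2

/-! ### Normalized powers of the sine -/

/-- `sin(θ/2)^(2n)` divided by its mean `C(2n,n) / 4^n` over `[0, π]`. -/
noncomputable def normSinPow (n : ℕ) (θ : ℝ) : ℝ :=
  4 ^ n / (n.centralBinom : ℝ) * sin (θ / 2) ^ (2 * n)

/-- The derivative of `normSinPow n`. -/
noncomputable def normSinPowDeriv (n : ℕ) (θ : ℝ) : ℝ :=
  n * (4 ^ n / (n.centralBinom : ℝ)) * (sin (θ / 2) ^ (2 * n - 1) * cos (θ / 2))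

theorem normSinPow_zero (θ : ℝ) : normSinPow 0 θ = 1 := by simp [normSinPow]

theorem normSinPow_succ_at_zero (n : ℕ) : normSinPow (n + 1) 0 = 0 := by
  simp [normSinPow]

theorem normSinPowDeriv_at_zero (n : ℕ) : normSinPowDeriv n 0 = 0 := by
  rcases n with _ | n
  · simp [normSinPowDeriv]
  · simp [normSinPowDeriv, show 2 * (n + 1) - 1 = 2 * n + 1 by omega]

theorem normSinPowDeriv_at_pi (n : ℕ) : normSinPowDeriv n π = 0 := by
  simp [normSinPowDeriv]

theorem normSinPow_nonneg (n : ℕ) (θ : ℝ) : 0 ≤ normSinPow n θ :=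
  mul_nonneg (by positivity) (by rw [pow_mul]; positivity)

@[fun_prop]
theorem continuous_normSinPow (n : ℕ) : Continuous (normSinPow n) := by
  unfold normSinPow; fun_prop

@[fun_prop]
theorem continuous_normSinPowDeriv (n : ℕ) : Continuous (normSinPowDeriv n) := by
  unfold normSinPowDeriv; fun_prop

theorem hasDerivAt_half (θ : ℝ) : HasDerivAt (fun θ : ℝ => θ / 2) (1 / 2) θ :=
  (hasDerivAt_id θ).div_const 2

theorem hasDerivAt_normSinPow (n : ℕ) (θ : ℝ) :
    HasDerivAt (normSinPow n) (normSinPowDeriv n θ) θ := by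
  have h := (((hasDerivAt_half θ).sin).pow (2 * n)).const_mul (4 ^ n / (n.centralBinom : ℝ))
  refine h.congr_deriv ?_
  unfold normSinPowDeriv
  push_cast
  ring

/-- The second-order relation `σₙ₊₁'' = (n + 1)² (σₙ - σₙ₊₁)` for `σₙ = normSinPow n`. -/
theorem hasDerivAt_normSinPowDeriv (n : ℕ) (θ : ℝ) :
    HasDerivAt (normSinPowDeriv (n + 1))
      (((n + 1 : ℕ) : ℝ) ^ 2 * (normSinPow n θ - normSinPow (n + 1) θ)) θ := by
  have h := ((((hasDerivAt_half θ).sin).pow (2 * n + 1)).mul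
    ((hasDerivAt_half θ).cos)).const_mul
      (((n + 1 : ℕ) : ℝ) * (4 ^ (n + 1) / ((n + 1).centralBinom : ℝ)))
  refine h.congr_deriv ?_
  rw [Pi.pow_apply]
  have hb : ((n : ℝ) + 1) * ((n + 1).centralBinom : ℝ) =
      2 * (2 * n + 1) * (n.centralBinom : ℝ) := by
    exact_mod_cast Nat.succ_mul_centralBinom_succ n
  have h0 : (n.centralBinom : ℝ) ≠ 0 := by exact_mod_cast n.centralBinom_ne_zero
  have hn : (n : ℝ) + 1 ≠ 0 := by positivity
  have hc : ((n + 1).centralBinom : ℝ) = 2 * (2 * n + 1) * (n.centralBinom : ℝ) / (n + 1) := by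
    rw [← hb]; field_simp
  have hcos := Real.cos_sq' (θ / 2)
  unfold normSinPow
  rw [hc]
  simp only [show 2 * (n + 1) = 2 * n + 2 by ring, add_tsub_cancel_right, pow_add, pow_one]
  push_cast
  field_simp
  rw [hcos]
  ring

theorem integral_normSinPow (n : ℕ) : ∫ θ in (0 : ℝ)..π, normSinPow n θ = π := by
  induction n with
  | zero => simp [normSinPow_zero]
  | succ n ih =>
    have h := integral_eq_sub_of_hasDerivAt (a := 0) (b := π)
      (fun θ _ => hasDerivAt_normSinPowDeriv n θ)
      (Continuous.intervalIntegrable (by fun_prop) _ _)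
    rw [normSinPowDeriv_at_pi, normSinPowDeriv_at_zero, sub_zero,
      intervalIntegral.integral_const_mul,
      intervalIntegral.integral_sub ((continuous_normSinPow n).intervalIntegrable _ _)
        ((continuous_normSinPow (n + 1)).intervalIntegrable _ _), ih] at h
    have hn : ((n + 1 : ℕ) : ℝ) ^ 2 ≠ 0 := by positivity
    have := (mul_eq_zero.1 h).resolve_left hn
    linarith

/-! ### The cotangent weight -/

/-- The weight `(π - θ) cot(θ/2)`. -/
noncomputable def cotWeight (θ : ℝ) : ℝ := (π - θ) * (cos (θ / 2) / sin (θ / 2))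

theorem cotWeight_nonneg {θ : ℝ} (h : θ ∈ Set.Icc 0 π) : 0 ≤ cotWeight θ :=
  mul_nonneg (sub_nonneg.2 h.2) (div_nonneg
    (cos_nonneg_of_neg_pi_div_two_le_of_le (by linarith [h.1, pi_pos]) (by linarith [h.2]))
    (sin_nonneg_of_nonneg_of_le_pi (by linarith [h.1]) (by linarith [h.2, h.1])))

/-- The weight sends `normSinPow (m + 1)` to a multiple of its derivative; at `θ = 0` both sides
vanish, with `x / 0 = 0` on the left. -/
theorem normSinPow_mul_cotWeight (m : ℕ) (θ : ℝ) :
    normSinPow (m + 1) θ * cotWeight θ =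
      1 / ((m + 1 : ℕ) : ℝ) * ((π - θ) * normSinPowDeriv (m + 1) θ) := by
  have hn : ((m + 1 : ℕ) : ℝ) ≠ 0 := by positivity
  unfold normSinPow cotWeight normSinPowDeriv
  rw [show 2 * (m + 1) - 1 = 2 * m + 1 by omega, show 2 * (m + 1) = 2 * m + 1 + 1 by ring]
  by_cases h : sin (θ / 2) = 0
  · simp [h]
  · rw [pow_succ (sin (θ / 2)) (2 * m + 1)]
    field_simp

/-- Integration by parts, `normSinPow (m + 1)` having mean `1`. -/
theorem integral_normSinPow_mul_cotWeight (m : ℕ) :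
    ∫ θ in (0 : ℝ)..π, normSinPow (m + 1) θ * cotWeight θ = π / ((m + 1 : ℕ) : ℝ) := by
  have h := integral_mul_deriv_eq_deriv_mul (a := 0) (b := π) (u := fun θ : ℝ => π - θ)
    (u' := fun _ => -1) (v := normSinPow (m + 1)) (v' := normSinPowDeriv (m + 1))
    (fun θ _ => (hasDerivAt_id θ).const_sub π) (fun θ _ => hasDerivAt_normSinPow _ θ)
    (Continuous.intervalIntegrable (by fun_prop) _ _)
    (Continuous.intervalIntegrable (by fun_prop) _ _)
  simp only [normSinPow_mul_cotWeight]
  rw [intervalIntegral.integral_const_mul, h, intervalIntegral.integral_const_mul,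
    integral_normSinPow, normSinPow_succ_at_zero]
  simp only [sub_self, zero_mul, mul_zero]
  ring

theorem intervalIntegrable_normSinPow_mul_cotWeight (m : ℕ) :
    IntervalIntegrable (fun θ => normSinPow (m + 1) θ * cotWeight θ) volume 0 π := by
  simp only [normSinPow_mul_cotWeight]
  exact Continuous.intervalIntegrable (by fun_prop) _ _

theorem sin_half_eq (θ : ℝ) : sin (θ / 2) = θ / 2 * sinc (θ / 2) := by
  by_cases h : θ = 0
  · simp [h]
  · rw [sinc_of_ne_zero (by simpa using h)]
    field_simp

theorem sinc_half_ne_zero {θ : ℝ} (h : θ ∈ Set.Icc 0 π) : sinc (θ / 2) ≠ 0 := by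
  by_cases h0 : θ = 0
  · simp [h0]
  · have h1 : 0 < θ := lt_of_le_of_ne h.1 (Ne.symm h0)
    have := sin_pos_of_pos_of_lt_pi (x := θ / 2) (by linarith) (by linarith [h.2, pi_pos])
    rw [sin_half_eq] at this
    exact fun h2 => by simp [h2] at this

/-- The weight has a simple pole at `0`, which one factor `θ` removes. -/
theorem intervalIntegrable_pow_mul_cotWeight (k : ℕ) :
    IntervalIntegrable (fun θ => θ ^ (k + 1) * cotWeight θ) volume 0 π := by
  have h : ContinuousOn (fun θ : ℝ => θ ^ k * (π - θ) * (2 * cos (θ / 2)) / sinc (θ / 2))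
      (Set.uIcc 0 π) := by
    rw [Set.uIcc_of_le pi_pos.le]
    refine ContinuousOn.div (by fun_prop) ?_ fun θ h => sinc_half_ne_zero h
    exact (continuous_sinc.comp (continuous_id.div_const 2)).continuousOn
  refine h.intervalIntegrable.congr fun θ hθ => ?_
  rw [Set.uIoc_of_le pi_pos.le] at hθ
  have h1 := sinc_half_ne_zero ⟨hθ.1.le, hθ.2⟩
  have h2 := hθ.1.ne'
  simp only [cotWeight, sin_half_eq, pow_succ]
  field_simp

theorem normSinPow_mono {n : ℕ} {θ T : ℝ} (h0 : 0 ≤ θ) (h1 : θ ≤ T) (h2 : T ≤ π) :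
    normSinPow n θ ≤ normSinPow n T := by
  unfold normSinPow
  have hs : 0 ≤ sin (θ / 2) := sin_nonneg_of_nonneg_of_le_pi (by linarith) (by linarith)
  have hst : sin (θ / 2) ≤ sin (T / 2) :=
    sin_le_sin_of_le_of_le_pi_div_two (by linarith [pi_pos]) (by linarith) (by linarith)
  gcongr

theorem tendsto_normSinPow {θ : ℝ} (h0 : 0 ≤ θ) (h1 : θ < π) :
    Tendsto (fun n => normSinPow n θ) atTop (𝓝 0) := by
  -- `4^n / C(2n,n) ≤ 2n`, so the geometric factor `r^n` wins
  set r := sin (θ / 2) ^ 2 with hr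
  have hs : 0 ≤ sin (θ / 2) := sin_nonneg_of_nonneg_of_le_pi (by linarith) (by linarith)
  have hs1 : sin (θ / 2) < 1 := by
    rw [← sin_pi_div_two]
    exact sin_lt_sin_of_lt_of_le_pi_div_two (by linarith [pi_pos]) le_rfl (by linarith)
  have hr0 : 0 ≤ r := by positivity
  have hr1 : r < 1 := pow_lt_one₀ hs hs1 two_ne_zero
  have hlim : Tendsto (fun n : ℕ => 2 * ((n : ℝ) * r ^ n)) atTop (𝓝 0) := by
    simpa using (tendsto_self_mul_const_pow_of_lt_one hr0 hr1).const_mul 2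
  refine squeeze_zero' (Eventually.of_forall fun n => normSinPow_nonneg n θ) ?_ hlim
  filter_upwards [eventually_gt_atTop 0] with n hn
  have hb : (0 : ℝ) < n.centralBinom := by exact_mod_cast n.centralBinom_pos
  have h4 : (4 : ℝ) ^ n ≤ 2 * n * n.centralBinom := by
    exact_mod_cast Nat.four_pow_le_two_mul_self_mul_centralBinom n hn
  have h5 : (4 : ℝ) ^ n / n.centralBinom ≤ 2 * n := (div_le_iff₀ hb).2 h4
  unfold normSinPow
  rw [pow_mul, ← hr]
  nlinarith [mul_le_mul_of_nonneg_right h5 (pow_nonneg hr0 n)]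

/-! ### Powers of the arcsine -/

theorem nonneg_of_hasDerivAt_nonneg {f f' : ℝ → ℝ} (hf : ∀ x, HasDerivAt f (f' x) x)
    (h0 : f 0 = 0) {T : ℝ} (h : ∀ x ∈ Set.Icc 0 T, 0 ≤ f' x) : ∀ x ∈ Set.Icc 0 T, 0 ≤ f x := by
  have hm : MonotoneOn f (Set.Icc 0 T) := by
    refine monotoneOn_of_deriv_nonneg (convex_Icc 0 T)
      (fun x _ => (hf x).continuousAt.continuousWithinAt)
      (fun x _ => (hf x).differentiableAt.differentiableWithinAt) fun x hx => ?_
    rw [(hf x).deriv]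
    exact h x (interior_subset hx)
  intro x hx
  rw [← h0]
  exact hm ⟨le_rfl, hx.1.trans hx.2⟩ hx hx.1

/-- The error of the partial sums of the expansion
`θ^(2M+2) / (2M+2)! = ∑_{m ≥ 1} (4^m / C(2m,m)) sin(θ/2)^(2m) e_M(m) / m²`,
a power of `arcsin` as a power series, where `e_M = truncTwos M`. -/
noncomputable def arcsinGap (M n : ℕ) (θ : ℝ) : ℝ :=
  θ ^ (2 * M + 2) / (2 * M + 2)! -
    ∑ m ∈ range n, normSinPow (m + 1) θ * (truncTwos M (m + 1) / ((m + 1 : ℕ) : ℝ) ^ 2)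

/-- The derivative of `arcsinGap M n`. -/
noncomputable def arcsinGapDeriv (M n : ℕ) (θ : ℝ) : ℝ :=
  θ ^ (2 * M + 1) / (2 * M + 1)! -
    ∑ m ∈ range n, normSinPowDeriv (m + 1) θ * (truncTwos M (m + 1) / ((m + 1 : ℕ) : ℝ) ^ 2)

theorem arcsinGap_at_zero (M n : ℕ) : arcsinGap M n 0 = 0 := by
  simp [arcsinGap, normSinPow_succ_at_zero]

theorem arcsinGapDeriv_at_zero (M n : ℕ) : arcsinGapDeriv M n 0 = 0 := by
  simp [arcsinGapDeriv, normSinPowDeriv_at_zero]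

theorem hasDerivAt_pow_div_factorial (k : ℕ) (θ : ℝ) :
    HasDerivAt (fun θ : ℝ => θ ^ (k + 1) / (k + 1)!) (θ ^ k / k !) θ := by
  refine ((hasDerivAt_pow (k + 1) θ).div_const _).congr_deriv ?_
  rw [Nat.factorial_succ]
  push_cast
  have : (k ! : ℝ) ≠ 0 := by positivity
  field_simp

theorem hasDerivAt_arcsinGap (M n : ℕ) (θ : ℝ) :
    HasDerivAt (arcsinGap M n) (arcsinGapDeriv M n θ) θ :=
  (hasDerivAt_pow_div_factorial (2 * M + 1) θ).sub
    (HasDerivAt.fun_sum fun m _ => (hasDerivAt_normSinPow (m + 1) θ).mul_const _)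

theorem hasDerivAt_arcsinGapDeriv (M n : ℕ) (θ : ℝ) :
    HasDerivAt (arcsinGapDeriv M n) (θ ^ (2 * M) / (2 * M)! -
      ∑ m ∈ range n, (normSinPow m θ - normSinPow (m + 1) θ) * truncTwos M (m + 1)) θ := by
  refine ((hasDerivAt_pow_div_factorial (2 * M) θ).sub
    (HasDerivAt.fun_sum fun m _ =>
      (hasDerivAt_normSinPowDeriv m θ).mul_const _)).congr_deriv ?_
  congr 1
  refine sum_congr rfl fun m _ => ?_
  have : ((m + 1 : ℕ) : ℝ) ≠ 0 := by positivity
  field_simp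

theorem hasDerivAt_arcsinGapDeriv_zero (n : ℕ) (θ : ℝ) :
    HasDerivAt (arcsinGapDeriv 0 n) (normSinPow n θ) θ := by
  refine (hasDerivAt_arcsinGapDeriv 0 n θ).congr_deriv ?_
  simp only [truncTwos, mul_one]
  rw [sum_range_sub' fun m => normSinPow m θ]
  simp [normSinPow_zero]

/-- Summation by parts turns the second derivative of one gap into the gap of depth one less. -/
theorem hasDerivAt_arcsinGapDeriv_succ (M n : ℕ) (θ : ℝ) :
    HasDerivAt (arcsinGapDeriv (M + 1) n)
      (arcsinGap M n θ + normSinPow n θ * truncTwos (M + 1) (n + 1)) θ := by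
  refine (hasDerivAt_arcsinGapDeriv (M + 1) n θ).congr_deriv ?_
  have key : ∑ m ∈ range n, (normSinPow m θ - normSinPow (m + 1) θ) * truncTwos (M + 1) (m + 1) =
      ∑ m ∈ range n, normSinPow (m + 1) θ * (truncTwos M (m + 1) / ((m + 1 : ℕ) : ℝ) ^ 2) -
        normSinPow n θ * truncTwos (M + 1) (n + 1) := by
    induction n with
    | zero => simp [truncTwos]
    | succ n ih =>
      have hrec : truncTwos (M + 1) (n + 1 + 1) = truncTwos (M + 1) (n + 1) +
          truncTwos M (n + 1) / ((n + 1 : ℕ) : ℝ) ^ 2 := by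
        simp only [truncTwos]
        rw [sum_range_succ]
      rw [sum_range_succ, sum_range_succ, ih, hrec]
      ring
  rw [key, arcsinGap, show 2 * (M + 1) = 2 * M + 2 by ring]
  ring

/-- Bounds on the second derivative integrate twice, the gap vanishing to second order at `0`. -/
theorem arcsinGap_bounds_of_deriv {M n : ℕ} {f : ℝ → ℝ} {B T : ℝ}
    (hf : ∀ θ, HasDerivAt (arcsinGapDeriv M n) (f θ) θ)
    (hB : ∀ θ ∈ Set.Icc 0 T, 0 ≤ f θ ∧ f θ ≤ B) :
    ∀ θ ∈ Set.Icc 0 T, 0 ≤ arcsinGap M n θ ∧ arcsinGap M n θ ≤ B * (θ ^ 2 / 2) := by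
  intro θ hθ
  refine ⟨nonneg_of_hasDerivAt_nonneg (hasDerivAt_arcsinGap M n) (arcsinGap_at_zero M n)
    (nonneg_of_hasDerivAt_nonneg hf (arcsinGapDeriv_at_zero M n) fun x hx => (hB x hx).1) θ hθ, ?_⟩
  have h1 : ∀ x : ℝ, HasDerivAt (fun x => B * x - arcsinGapDeriv M n x) (B - f x) x := fun x => by
    refine (((hasDerivAt_id x).const_mul B).sub (hf x)).congr_deriv ?_
    simp
  have h2 : ∀ x : ℝ, HasDerivAt (fun x => B * (x ^ 2 / 2) - arcsinGap M n x)
      (B * x - arcsinGapDeriv M n x) x := fun x => by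
    refine ((((hasDerivAt_pow 2 x).div_const 2).const_mul B).sub
      (hasDerivAt_arcsinGap M n x)).congr_deriv ?_
    simp
  have := nonneg_of_hasDerivAt_nonneg h2 (by simp [arcsinGap_at_zero])
    (nonneg_of_hasDerivAt_nonneg h1 (by simp [arcsinGapDeriv_at_zero])
      fun x hx => sub_nonneg.2 (hB x hx).2) θ hθ
  linarith

/-- The gap is nonnegative and controlled by `normSinPow n`, uniformly on `[0, T]`. -/
theorem exists_arcsinGap_le (M : ℕ) : ∃ C : ℝ, 0 ≤ C ∧ ∀ n : ℕ, ∀ T ≤ π, ∀ θ ∈ Set.Icc 0 T,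
    0 ≤ arcsinGap M n θ ∧ arcsinGap M n θ ≤ C * normSinPow n T := by
  have step : ∀ {B θ T : ℝ}, 0 ≤ B → T ≤ π → θ ∈ Set.Icc 0 T →
      B * (θ ^ 2 / 2) ≤ B * (π ^ 2 / 2) := fun hB hT hθ => by
    have := hθ.1
    have := hθ.2.trans hT
    gcongr
  induction M with
  | zero =>
    refine ⟨π ^ 2 / 2, by positivity, fun n T hT θ hθ => ?_⟩
    obtain ⟨h1, h2⟩ := arcsinGap_bounds_of_deriv (B := normSinPow n T)
      (hasDerivAt_arcsinGapDeriv_zero n)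
      (fun x hx => ⟨normSinPow_nonneg n x, normSinPow_mono hx.1 hx.2 hT⟩) θ hθ
    refine ⟨h1, h2.trans ?_⟩
    rw [mul_comm (π ^ 2 / 2)]
    exact step (normSinPow_nonneg n T) hT hθ
  | succ M ih =>
    obtain ⟨C, hC, h⟩ := ih
    obtain ⟨E, hE, hE'⟩ := exists_truncTwos_le (M + 1)
    refine ⟨(C + E) * (π ^ 2 / 2), by positivity, fun n T hT θ hθ => ?_⟩
    have hB : 0 ≤ (C + E) * normSinPow n T := mul_nonneg (by positivity) (normSinPow_nonneg n T)
    obtain ⟨h1, h2⟩ := arcsinGap_bounds_of_deriv (B := (C + E) * normSinPow n T)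
      (hasDerivAt_arcsinGapDeriv_succ M n)
      (fun x hx => by
        obtain ⟨h3, h4⟩ := h n T hT x hx
        have h5 := normSinPow_mono (n := n) hx.1 hx.2 hT
        have h6 := mul_le_mul h5 (hE' (n + 1)) (truncTwos_nonneg _ _) (normSinPow_nonneg n T)
        exact ⟨add_nonneg h3 (mul_nonneg (normSinPow_nonneg n x) (truncTwos_nonneg _ _)),
          by linarith⟩) θ hθ
    refine ⟨h1, (h2.trans (step hB hT hθ)).trans_eq (by ring)⟩

theorem arcsinGap_nonneg (M n : ℕ) {θ : ℝ} (h : θ ∈ Set.Icc 0 π) : 0 ≤ arcsinGap M n θ := by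
  obtain ⟨C, -, hC⟩ := exists_arcsinGap_le M
  exact (hC n π le_rfl θ h).1

theorem tendsto_arcsinGap (M : ℕ) {θ : ℝ} (h0 : 0 ≤ θ) (h1 : θ < π) :
    Tendsto (fun n => arcsinGap M n θ) atTop (𝓝 0) := by
  obtain ⟨C, -, hC⟩ := exists_arcsinGap_le M
  refine squeeze_zero (fun n => (hC n θ h1.le θ ⟨h0, le_rfl⟩).1)
    (fun n => (hC n θ h1.le θ ⟨h0, le_rfl⟩).2) ?_
  simpa using (tendsto_normSinPow h0 h1).const_mul C

theorem arcsinGap_le (M n : ℕ) (θ : ℝ) : arcsinGap M n θ ≤ θ ^ (2 * M + 2) / (2 * M + 2)! :=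
  sub_le_self _ (sum_nonneg fun m _ => mul_nonneg (normSinPow_nonneg _ _)
    (div_nonneg (truncTwos_nonneg _ _) (by positivity)))

/-! ### The integral representation -/

/-- Dominated convergence, the dominating function being the gap for the empty partial sum. -/
theorem tendsto_integral_arcsinGap_mul_cotWeight (M : ℕ) :
    Tendsto (fun n => ∫ θ in (0 : ℝ)..π, arcsinGap M n θ * cotWeight θ) atTop (𝓝 0) := by
  have h := tendsto_integral_filter_of_dominated_convergence (a := 0) (b := π) (μ := volume)
    (l := atTop) (F := fun n θ => arcsinGap M n θ * cotWeight θ) (f := fun _ => (0 : ℝ))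
    (fun θ => 1 / (2 * M + 2)! * (θ ^ (2 * M + 2) * cotWeight θ)) ?_ ?_ ?_ ?_
  · simpa using h
  · refine Eventually.of_forall fun n => Measurable.aestronglyMeasurable ?_
    refine Measurable.mul (Continuous.measurable ?_) ?_
    · unfold arcsinGap
      fun_prop
    · unfold cotWeight
      fun_prop
  · refine Eventually.of_forall fun n => Eventually.of_forall fun θ hθ => ?_
    rw [Set.uIoc_of_le pi_pos.le] at hθ
    have hθ' : θ ∈ Set.Icc 0 π := ⟨hθ.1.le, hθ.2⟩
    rw [Real.norm_of_nonneg (mul_nonneg (arcsinGap_nonneg M n hθ') (cotWeight_nonneg hθ'))]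
    refine (mul_le_mul_of_nonneg_right (arcsinGap_le M n θ) (cotWeight_nonneg hθ')).trans_eq ?_
    ring
  · exact (intervalIntegrable_pow_mul_cotWeight (2 * M + 1)).const_mul _
  · -- the gap does not tend to `0` at the end point `π`
    have hne : ∀ᵐ θ : ℝ, θ ≠ π := by
      simp [ae_iff]
    filter_upwards [hne] with θ h1 hθ
    rw [Set.uIoc_of_le pi_pos.le] at hθ
    simpa using (tendsto_arcsinGap M hθ.1.le (lt_of_le_of_ne hθ.2 h1)).mul_const (cotWeight θ)

theorem integral_arcsinGap_mul_cotWeight (M n : ℕ) :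
    ∫ θ in (0 : ℝ)..π, arcsinGap M n θ * cotWeight θ =
      1 / (2 * M + 2)! * (∫ θ in (0 : ℝ)..π, θ ^ (2 * M + 2) * cotWeight θ) -
        π * ∑ m ∈ range n, truncTwos M (m + 1) / ((m + 1 : ℕ) : ℝ) ^ 3 := by
  have h1 : ∀ θ, arcsinGap M n θ * cotWeight θ =
      1 / (2 * M + 2)! * (θ ^ (2 * M + 2) * cotWeight θ) -
        ∑ m ∈ range n, truncTwos M (m + 1) / ((m + 1 : ℕ) : ℝ) ^ 2 *
          (normSinPow (m + 1) θ * cotWeight θ) := fun θ => by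
    rw [arcsinGap, sub_mul, sum_mul]
    congr 1
    · ring
    · exact sum_congr rfl fun m _ => by ring
  simp only [h1]
  have h2 : ∀ m ∈ range n, IntervalIntegrable (fun θ => truncTwos M (m + 1) /
      ((m + 1 : ℕ) : ℝ) ^ 2 * (normSinPow (m + 1) θ * cotWeight θ)) volume 0 π := fun m _ =>
    (intervalIntegrable_normSinPow_mul_cotWeight m).const_mul _
  rw [intervalIntegral.integral_sub
    ((intervalIntegrable_pow_mul_cotWeight (2 * M + 1)).const_mul _)
    (by simpa only [Finset.sum_fn] using IntervalIntegrable.sum (range n) h2),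
    intervalIntegral.integral_finsetSum h2, intervalIntegral.integral_const_mul, mul_sum]
  congr 1
  refine sum_congr rfl fun m _ => ?_
  rw [intervalIntegral.integral_const_mul, integral_normSinPow_mul_cotWeight]
  have : ((m + 1 : ℕ) : ℝ) ≠ 0 := by positivity
  field_simp

/-- The integral representation
`ζ(3, {2}^M) = 1 / (π (2M+2)!) ∫₀^π θ^(2M+2) (π - θ) cot(θ/2) dθ`. -/
theorem hasSum_truncTwos_div_cube (M : ℕ) :
    HasSum (fun m : ℕ => truncTwos M (m + 1) / ((m + 1 : ℕ) : ℝ) ^ 3)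
      (1 / (π * (2 * M + 2)!) * ∫ θ in (0 : ℝ)..π, θ ^ (2 * M + 2) * cotWeight θ) := by
  rw [hasSum_iff_tendsto_nat_of_nonneg fun m =>
    div_nonneg (truncTwos_nonneg _ _) (by positivity)]
  have h := tendsto_integral_arcsinGap_mul_cotWeight M
  simp only [integral_arcsinGap_mul_cotWeight] at h
  have h' := (h.const_sub (1 / (2 * M + 2)! *
    (∫ θ in (0 : ℝ)..π, θ ^ (2 * M + 2) * cotWeight θ))).const_mul (1 / π)
  have hf : ((2 * M + 2)! : ℝ) ≠ 0 := by positivity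
  refine (h'.congr fun n => ?_).trans_eq ?_
  · field_simp
    ring
  · congr 1
    field_simp
    ring

/-! ### The sine series of the cotangent -/

/-- The finite Fourier expansion of the cotangent, cleared of its denominator. -/
theorem cos_half_eq_sum_sin (n : ℕ) (θ : ℝ) :
    cos (θ / 2) = 2 * (∑ k ∈ range n, sin ((k + 1 : ℕ) * θ)) * sin (θ / 2) +
      cos ((n + 1 / 2) * θ) := by
  induction n with
  | zero => simp; ring_nf
  | succ n ih =>
    have h1 : cos ((n + 1 / 2) * θ) =
        cos ((n + 1 : ℕ) * θ) * cos (θ / 2) + sin ((n + 1 : ℕ) * θ) * sin (θ / 2) := by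
      rw [← cos_sub]; congr 1; push_cast; ring
    have h2 : cos (((n + 1 : ℕ) + 1 / 2) * θ) =
        cos ((n + 1 : ℕ) * θ) * cos (θ / 2) - sin ((n + 1 : ℕ) * θ) * sin (θ / 2) := by
      rw [← cos_add]; congr 1; ring
    rw [h1] at ih
    rw [h2, sum_range_succ]
    linear_combination ih

/-- The Riemann-Lebesgue lemma on `[0, π]`, along half-integer frequencies. -/
theorem tendsto_integral_mul_cos {h : ℝ → ℝ} (hh : IntervalIntegrable h volume 0 π) :
    Tendsto (fun n : ℕ => ∫ θ in (0 : ℝ)..π, h θ * cos ((n + 1 / 2) * θ)) atTop (𝓝 0) := by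
  have hw : Tendsto (fun n : ℕ => ((n : ℝ) + 1 / 2) / (2 * π)) atTop (cocompact ℝ) :=
    ((tendsto_natCast_atTop_atTop.atTop_add tendsto_const_nhds).atTop_div_const
      (by positivity)).mono_right atTop_le_cocompact
  have hRL := (Real.tendsto_integral_exp_smul_cocompact
    (Set.indicator (Set.Ioc 0 π) fun θ => (h θ : ℂ))).comp hw
  have hre := (Complex.continuous_re.tendsto _).comp hRL
  rw [Complex.zero_re] at hre
  refine hre.congr fun n => ?_
  simp only [Function.comp_apply]
  have hi := (intervalIntegrable_iff_integrableOn_Ioc_of_le pi_pos.le).1 hh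
  have hint : Integrable (fun v : ℝ => Real.fourierChar (-(v * (((n : ℝ) + 1 / 2) / (2 * π)))) •
      Set.indicator (Set.Ioc 0 π) (fun θ => (h θ : ℂ)) v) := by
    have := (Real.fourierIntegral_convergent_iff (μ := volume)
      (f := Set.indicator (Set.Ioc 0 π) (fun θ => (h θ : ℂ))) (((n : ℝ) + 1 / 2) / (2 * π))).2
      ((integrable_indicator_iff measurableSet_Ioc).2 hi.ofReal)
    simpa [mul_comm] using this
  rw [← Complex.reCLM_apply, ← Complex.reCLM.integral_comp_comm hint,
    intervalIntegral.integral_of_le pi_pos.le, ← MeasureTheory.integral_indicator measurableSet_Ioc]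
  refine MeasureTheory.integral_congr_ae (Eventually.of_forall fun v => ?_)
  simp only [Complex.reCLM_apply, Set.indicator_apply]
  split_ifs
  · rw [Circle.smul_def, Real.fourierChar_apply, smul_eq_mul, Complex.re_mul_ofReal,
      Complex.exp_ofReal_mul_I_re, mul_comm]
    congr 1
    rw [← cos_neg]
    congr 1
    field_simp
  · simp

/-- The cotangent weight may be replaced by the sine series of `cot(θ/2)`, summed termwise. -/
theorem tendsto_sum_integral_sin (k : ℕ) :
    Tendsto (fun n : ℕ => ∑ j ∈ range n,
      2 * ∫ θ in (0 : ℝ)..π, θ ^ (k + 1) * (π - θ) * sin ((j + 1 : ℕ) * θ)) atTop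
      (𝓝 (∫ θ in (0 : ℝ)..π, θ ^ (k + 1) * cotWeight θ)) := by
  -- `sinc` in place of `sin` removes the singularity at `0` of the remainder in the kernel
  have hc : ContinuousOn (fun θ : ℝ => θ ^ k * (π - θ) * 2 / sinc (θ / 2)) (Set.uIcc 0 π) := by
    rw [Set.uIcc_of_le pi_pos.le]
    refine ContinuousOn.div (by fun_prop) ?_ fun θ h => sinc_half_ne_zero h
    exact (continuous_sinc.comp (continuous_id.div_const 2)).continuousOn
  have hRL := (tendsto_integral_mul_cos hc.intervalIntegrable).const_sub
    (∫ θ in (0 : ℝ)..π, θ ^ (k + 1) * cotWeight θ)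
  rw [sub_zero] at hRL
  refine hRL.congr fun n => ?_
  have hci : IntervalIntegrable (fun θ : ℝ => θ ^ k * (π - θ) * 2 / sinc (θ / 2) *
      cos ((n + 1 / 2) * θ)) volume 0 π :=
    (hc.mul (Continuous.continuousOn (by fun_prop))).intervalIntegrable
  rw [← intervalIntegral.integral_sub (intervalIntegrable_pow_mul_cotWeight k) hci]
  simp only [← intervalIntegral.integral_const_mul]
  rw [← intervalIntegral.integral_finsetSum
    fun j _ => Continuous.intervalIntegrable (by fun_prop) _ _]
  refine intervalIntegral.integral_congr_ae (Eventually.of_forall fun θ hθ => ?_)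
  rw [Set.uIoc_of_le pi_pos.le] at hθ
  have h1 := sinc_half_ne_zero ⟨hθ.1.le, hθ.2⟩
  have h2 := hθ.1.ne'
  have h3 := cos_half_eq_sum_sin n θ
  rw [← mul_sum, ← mul_sum]
  rw [sin_half_eq] at h3
  simp only [cotWeight, sin_half_eq]
  rw [h3, pow_succ]
  field_simp
  ring

/-! ### Sine coefficients of polynomials -/

open Polynomial in
/-- Two integrations by parts. -/
theorem integral_polynomial_mul_sin (p : ℝ[X]) {K : ℕ} (hK : K ≠ 0) :
    ∫ θ in (0 : ℝ)..π, p.eval θ * sin (K * θ) =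
      (p.eval 0 - (-1) ^ K * p.eval π) / K -
        1 / (K : ℝ) ^ 2 * ∫ θ in (0 : ℝ)..π, (derivative^[2] p).eval θ * sin (K * θ) := by
  have hK' : (K : ℝ) ≠ 0 := by exact_mod_cast hK
  have hd : ∀ θ : ℝ, HasDerivAt (fun θ => p.derivative.eval θ * sin (K * θ) / (K : ℝ) ^ 2 -
      p.eval θ * cos (K * θ) / K)
      (p.eval θ * sin (K * θ) +
        1 / (K : ℝ) ^ 2 * ((derivative^[2] p).eval θ * sin (K * θ))) θ := fun θ => by
    have hl : HasDerivAt (fun θ : ℝ => (K : ℝ) * θ) K θ := by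
      simpa using (hasDerivAt_id θ).const_mul (K : ℝ)
    refine (((p.derivative.hasDerivAt θ).mul hl.sin).div_const ((K : ℝ) ^ 2) |>.sub
      (((p.hasDerivAt θ).mul hl.cos).div_const (K : ℝ))).congr_deriv ?_
    simp only [Function.iterate_succ, Function.iterate_zero, Function.comp_apply, id]
    field_simp
    ring
  have h := integral_eq_sub_of_hasDerivAt (a := 0) (b := π) (fun θ _ => hd θ)
    (Continuous.intervalIntegrable (by fun_prop) _ _)
  rw [intervalIntegral.integral_add (Continuous.intervalIntegrable (by fun_prop) _ _)
    (Continuous.intervalIntegrable (by fun_prop) _ _),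
    intervalIntegral.integral_const_mul] at h
  rw [eq_sub_iff_add_eq, h, cos_nat_mul_pi, sin_nat_mul_pi]
  simp only [mul_zero, sin_zero, cos_zero, zero_div]
  ring

open Polynomial in
theorem integral_polynomial_mul_sin_iterate (p : ℝ[X]) {K : ℕ} (hK : K ≠ 0) (J : ℕ) :
    ∫ θ in (0 : ℝ)..π, p.eval θ * sin (K * θ) =
      ∑ j ∈ range J, (-1) ^ j *
        ((derivative^[2 * j] p).eval 0 - (-1) ^ K * (derivative^[2 * j] p).eval π) /
          (K : ℝ) ^ (2 * j + 1) +
      (-1) ^ J / (K : ℝ) ^ (2 * J) *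
        ∫ θ in (0 : ℝ)..π, (derivative^[2 * J] p).eval θ * sin (K * θ) := by
  have hK' : (K : ℝ) ≠ 0 := by exact_mod_cast hK
  induction J with
  | zero => simp
  | succ J ih =>
    rw [ih, sum_range_succ, integral_polynomial_mul_sin _ hK, ← Function.iterate_add_apply,
      show 2 + 2 * J = 2 * (J + 1) by ring]
    field_simp
    ring

theorem descFactorial_sub_descFactorial {M j : ℕ} (hj : j ≤ M) :
    ((2 * M).descFactorial (2 * j) : ℝ) - ((2 * M + 1).descFactorial (2 * j) : ℝ) =
      -((2 * M)! * (2 * j) / (2 * M + 1 - 2 * j)!) := by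
  obtain ⟨r, rfl⟩ := Nat.exists_eq_add_of_le hj
  have h1 := Nat.factorial_mul_descFactorial (n := 2 * (j + r)) (k := 2 * j) (by omega)
  have h2 := Nat.factorial_mul_descFactorial (n := 2 * (j + r) + 1) (k := 2 * j) (by omega)
  rw [show 2 * (j + r) - 2 * j = 2 * r by omega] at h1
  rw [show 2 * (j + r) + 1 - 2 * j = 2 * r + 1 by omega] at h2 ⊢
  rw [Nat.factorial_succ (2 * (j + r)), ← h1, Nat.factorial_succ (2 * r)] at h2
  have h2' : ((2 * (r : ℝ) + 1) * (2 * r)!) * ((2 * (j + r) + 1).descFactorial (2 * j) : ℝ) =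
      (2 * (j + r) + 1) * ((2 * r)! * ((2 * (j + r)).descFactorial (2 * j))) := by
    exact_mod_cast h2
  have h1' : ((2 * (j + r))! : ℝ) = (2 * r)! * ((2 * (j + r)).descFactorial (2 * j)) := by
    exact_mod_cast h1.symm
  have hr : ((2 * r)! : ℝ) ≠ 0 := by positivity
  have hr' : (2 * (r : ℝ) + 1) ≠ 0 := by positivity
  rw [h1', Nat.factorial_succ]
  push_cast
  field_simp
  have h3 : (2 * (r : ℝ) + 1) * ((2 * (j + r) + 1).descFactorial (2 * j) : ℝ) =
      (2 * (j + r) + 1) * ((2 * (j + r)).descFactorial (2 * j)) := by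
    apply mul_left_cancel₀ hr
    linear_combination h2'
  linear_combination -h3

/-- Only finitely many iterated derivatives of `θ^(2M) (π - θ)` survive in repeated integration by
parts; this gives the sine coefficients of that polynomial on `[0, π]`. -/
theorem integral_pow_mul_sin (M : ℕ) {K : ℕ} (hK : K ≠ 0) :
    ∫ θ in (0 : ℝ)..π, θ ^ (2 * M) * (π - θ) * sin (K * θ) =
      π * (2 * M)! * ((-1) ^ M * (1 / (K : ℝ) ^ (2 * M + 1)) +
        ∑ j ∈ range (M + 1), (-1) ^ j * (2 * j) * π ^ (2 * M - 2 * j) / (2 * M + 1 - 2 * j)! *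
          ((-1) ^ K / (K : ℝ) ^ (2 * j + 1))) := by
  have h := integral_polynomial_mul_sin_iterate
    (Polynomial.C π * Polynomial.X ^ (2 * M) - Polynomial.X ^ (2 * M + 1)) hK (M + 1)
  have hd : ∀ j (θ : ℝ), (Polynomial.derivative^[j]
      (Polynomial.C π * Polynomial.X ^ (2 * M) - Polynomial.X ^ (2 * M + 1))).eval θ =
      π * ((2 * M).descFactorial j * θ ^ (2 * M - j)) -
        (2 * M + 1).descFactorial j * θ ^ (2 * M + 1 - j) := fun j θ => by
    rw [Polynomial.iterate_derivative_sub, Polynomial.iterate_derivative_C_mul,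
      Polynomial.iterate_derivative_X_pow_eq_natCast_mul,
      Polynomial.iterate_derivative_X_pow_eq_natCast_mul]
    simp
  simp only [hd] at h
  rw [Nat.descFactorial_of_lt (show 2 * M < 2 * (M + 1) by omega),
    Nat.descFactorial_of_lt (show 2 * M + 1 < 2 * (M + 1) by omega)] at h
  have hl : ∀ θ : ℝ, θ ^ (2 * M) * (π - θ) * sin (K * θ) = Polynomial.eval θ
      (Polynomial.C π * Polynomial.X ^ (2 * M) - Polynomial.X ^ (2 * M + 1)) * sin (K * θ) :=
    fun θ => by
      rw [Polynomial.eval_sub, Polynomial.eval_mul, Polynomial.eval_C, Polynomial.eval_pow,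
        Polynomial.eval_pow, Polynomial.eval_X]
      ring
  simp only [hl]
  rw [h]
  simp only [Nat.cast_zero, zero_mul, mul_zero, sub_zero, intervalIntegral.integral_zero, add_zero]
  rw [mul_add, mul_sum]
  -- the boundary terms at `0` vanish except for `j = M`
  have hz : π * (2 * M)! * ((-1) ^ M * (1 / (K : ℝ) ^ (2 * M + 1))) =
      ∑ j ∈ range (M + 1), if j = M then
        π * (2 * M)! * ((-1) ^ M * (1 / (K : ℝ) ^ (2 * M + 1))) else 0 := by
    simp
  rw [hz, ← sum_add_distrib]
  refine sum_congr rfl fun j hj => ?_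
  have hjM : j ≤ M := Nat.lt_succ_iff.1 (mem_range.1 hj)
  have hpi : π * ((2 * M).descFactorial (2 * j) * π ^ (2 * M - 2 * j)) -
      (2 * M + 1).descFactorial (2 * j) * π ^ (2 * M + 1 - 2 * j) =
      -((2 * M)! * (2 * j) / (2 * M + 1 - 2 * j)!) * (π * π ^ (2 * M - 2 * j)) := by
    rw [← descFactorial_sub_descFactorial hjM,
      show 2 * M + 1 - 2 * j = 2 * M - 2 * j + 1 by omega, pow_succ]
    ring
  rw [hpi, zero_pow (show 2 * M + 1 - 2 * j ≠ 0 by omega)]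
  split_ifs with hjM'
  · subst hjM'
    rw [Nat.descFactorial_self, Nat.sub_self, pow_zero]
    ring
  · rw [zero_pow (show 2 * M - 2 * j ≠ 0 by omega)]
    ring

/-! ### Zeta and eta values -/

/-- The alternating zeta series, the even terms being counted twice with the opposite sign. -/
theorem hasSum_alternating {m : ℕ} (hm : 1 < m) :
    HasSum (fun n : ℕ => (-1 : ℝ) ^ (n + 1) / ((n + 1 : ℕ) : ℝ) ^ m)
      (-((1 - 2 / 2 ^ m) * ∑' n : ℕ, 1 / (n : ℝ) ^ m)) := by
  have hs := (Real.summable_one_div_nat_pow.2 hm).hasSum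
  have hinj : Function.Injective fun n : ℕ => 2 * n := fun a b h => by simpa using h
  have heven : HasSum (fun n : ℕ => if Even n then 1 / (n : ℝ) ^ m else 0)
      (1 / 2 ^ m * ∑' n : ℕ, 1 / (n : ℝ) ^ m) := by
    rw [← hinj.hasSum_iff]
    · refine (hs.mul_left (1 / 2 ^ m)).congr_fun fun n => ?_
      simp [mul_pow, mul_comm]
    · intro n hn
      rw [if_neg]
      rintro ⟨r, rfl⟩
      exact hn ⟨r, by simp; ring⟩
  have h := (heven.mul_left 2).sub hs
  rw [← hasSum_nat_add_iff' 1] at h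
  rw [sum_range_one, if_pos Even.zero, Nat.cast_zero, zero_pow (by omega)] at h
  rw [show -((1 - 2 / 2 ^ m) * ∑' n : ℕ, 1 / (n : ℝ) ^ m) =
    2 * (1 / 2 ^ m * ∑' n : ℕ, 1 / (n : ℝ) ^ m) - ∑' n : ℕ, 1 / (n : ℝ) ^ m -
      (2 * (1 / 0) - 1 / 0) by ring]
  refine h.congr_fun fun n => ?_
  by_cases hn : Even (n + 1)
  · rw [if_pos hn, hn.neg_one_pow]; ring
  · rw [if_neg hn, (Nat.not_even_iff_odd.1 hn).neg_one_pow]; ring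

theorem hasSum_one_div_succ_pow {m : ℕ} (hm : 1 < m) :
    HasSum (fun n : ℕ => 1 / ((n + 1 : ℕ) : ℝ) ^ m) (∑' n : ℕ, 1 / (n : ℝ) ^ m) := by
  have h := (Real.summable_one_div_nat_pow.2 hm).hasSum
  rw [← hasSum_nat_add_iff' 1] at h
  simpa [zero_pow (show m ≠ 0 by omega)] using h

/-- Evaluation of the cotangent integral by zeta and alternating zeta values. -/
theorem integral_pow_mul_cotWeight (N : ℕ) :
    ∫ θ in (0 : ℝ)..π, θ ^ (2 * N + 2) * cotWeight θ =
      2 * (π * (2 * N + 2)! * ((-1) ^ (N + 1) * (∑' n : ℕ, 1 / (n : ℝ) ^ (2 * N + 3)) +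
        ∑ j ∈ range (N + 2), (-1) ^ j * (2 * j) * π ^ (2 * N + 2 - 2 * j) /
          (2 * N + 3 - 2 * j)! *
          (-((1 - 2 / 2 ^ (2 * j + 1)) * ∑' n : ℕ, 1 / (n : ℝ) ^ (2 * j + 1))))) := by
  refine tendsto_nhds_unique (tendsto_sum_integral_sin (2 * N + 1)) ?_
  refine HasSum.tendsto_sum_nat (HasSum.mul_left 2 ?_)
  have hI : ∀ j : ℕ, ∫ θ in (0 : ℝ)..π, θ ^ (2 * N + 1 + 1) * (π - θ) * sin ((j + 1 : ℕ) * θ) = _ :=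
    fun j => integral_pow_mul_sin (N + 1) j.succ_ne_zero
  simp only [hI]
  refine HasSum.mul_left _ (HasSum.add ?_ (hasSum_sum fun j _ => ?_))
  · exact (hasSum_one_div_succ_pow (by omega)).mul_left _
  · rcases Nat.eq_zero_or_pos j with rfl | hj
    · -- the term `j = 0`, a conditionally convergent series, has coefficient `0`
      simp
    · exact (hasSum_alternating (by omega)).mul_left _

theorem tsum_eq_riemannZeta {m : ℕ} (hm : 1 < m) :
    ((∑' n : ℕ, 1 / (n : ℝ) ^ m : ℝ) : ℂ) = riemannZeta m := by
  rw [zeta_nat_eq_tsum_of_gt_one hm]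
  push_cast
  rfl

theorem dirichletEtaNat_eq {m : ℕ} (hm : 1 < m) :
    (((1 - 2 / 2 ^ m) * ∑' n : ℕ, 1 / (n : ℝ) ^ m : ℝ) : ℂ) = dirichletEtaNat m := by
  rw [dirichletEtaNat, if_neg (by omega), Complex.ofReal_mul, tsum_eq_riemannZeta hm,
    zpow_sub₀ two_ne_zero]
  simp

theorem theorem3p2 (N : ℕ) :
    Summable (mzvTerm (threeTwos N)) ∧
    ((multipleZeta (threeTwos N) : ℝ) : ℂ) =
      2 * ((∑ j ∈ Finset.Icc 1 N,
              (-1 : ℂ) ^ (j + 1) * (2 * (j : ℂ)) * (Real.pi : ℂ) ^ (2 * N + 2 - 2 * j)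
                / (Nat.factorial (2 * N + 3 - 2 * j) : ℂ) * dirichletEtaNat (2 * j + 1))
            - (-1 : ℂ) ^ N *
                (1 - (1 - (2 : ℂ) ^ (-2 * (N : ℤ) - 2)) * (2 * (N : ℂ) + 2)) *
                riemannZeta (2 * (N : ℂ) + 3)) := by
  have h := hasSum_mzvTerm_threeTwos (hasSum_truncTwos_div_cube N)
  refine ⟨h.summable, ?_⟩
  have hf : (π * (2 * N + 2)! : ℝ) ≠ 0 := by positivity
  rw [multipleZeta, h.tsum_eq, integral_pow_mul_cotWeight, mul_left_comm, ← mul_assoc (1 / _),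
    one_div_mul_cancel hf, one_mul, sum_range_succ, sum_range_succ']
  have hz : riemannZeta (2 * (N : ℂ) + 3) =
      ((∑' n : ℕ, 1 / (n : ℝ) ^ (2 * N + 3) : ℝ) : ℂ) := by
    rw [tsum_eq_riemannZeta (by omega)]
    push_cast
    rfl
  have h2 : (2 : ℂ) ^ (-2 * (N : ℤ) - 2) = 1 / 2 ^ (2 * N + 2) := by
    rw [one_div, ← zpow_natCast, ← zpow_neg]
    congr 1
    push_cast
    ring
  have hIcc : ∀ f : ℕ → ℂ, ∑ j ∈ Icc 1 N, f j = ∑ j ∈ range N, f (j + 1) := fun f => by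
    rw [range_eq_Ico, sum_Ico_add' f 0 N 1]
    rfl
  have hsum : ∑ j ∈ range N, (-1 : ℂ) ^ (j + 1 + 1) * (2 * ((j + 1 : ℕ) : ℂ)) *
      (π : ℂ) ^ (2 * N + 2 - 2 * (j + 1)) / ((2 * N + 3 - 2 * (j + 1))! : ℂ) *
        dirichletEtaNat (2 * (j + 1) + 1) =
      ((∑ j ∈ range N, (-1) ^ (j + 1) * (2 * ((j + 1 : ℕ) : ℝ)) *
        π ^ (2 * N + 2 - 2 * (j + 1)) / (2 * N + 3 - 2 * (j + 1))! *
          -((1 - 2 / 2 ^ (2 * (j + 1) + 1)) * ∑' n : ℕ, 1 / (n : ℝ) ^ (2 * (j + 1) + 1)) : ℝ) :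
        ℂ) := by
    rw [Complex.ofReal_sum]
    refine sum_congr rfl fun j _ => ?_
    rw [← dirichletEtaNat_eq (by omega)]
    push_cast
    ring
  rw [hz, h2, hIcc, hsum, show 2 * (N + 1) + 1 = 2 * N + 3 by ring,
    show 2 * N + 2 - 2 * (N + 1) = 0 by omega, show 2 * N + 3 - 2 * (N + 1) = 1 by omega]
  generalize (∑ j ∈ range N, _ : ℝ) = S
  generalize (∑' n : ℕ, 1 / (n : ℝ) ^ (2 * N + 3)) = z
  push_cast
  simp only [Nat.factorial_one, Nat.cast_one, pow_zero]
  ring
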